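/- Let $n\ge 3$, let $\mathbb K$ be a field, let $V$ be a $2n$-dimensional $\mathbb K$-vector space and let $q$ be a non-degenerate quadratic form on $V$ of Witt index $n$ (non-degenerate means that no non-zero singular vector is orthogonal to all of $V$ for the polar form of $q$). Let $B_n^+(\mathbb K)$ be the polar space of $q$, namely the top-thin polar space associated with $\mathrm O^+(2n,\mathbb K)$: its elements of type $k$ are the $k$-dimensional totally singular subspaces of $V$. Let $\mathrm{Gr}_{n-1}(B_n^+(\mathbb K))$ be the point-line geometry whose points are the $(n-1)$-dimensional totally singular subspaces of $V$ and whose lines are the sets $\{Y : \dim Y=n-1,\ X\subset Y\subset M\}$, where $M$ is an $n$-dimensional totally singular subspace and $X$ is an $(n-2)$-dimensional subspace of $M$. A subspace of a point-line geometry is a set of points containing every line with which it shares at least two points; a set of points generates the geometry if the only subspace containing it is the whole point-set. Given a basis $E=(e_1,\dots,e_{2n})$ of $V$ with respect to which $q(x_1,\dots,x_{2n})=x_1x_2+x_3x_4+\dots+x_{2n-1}x_{2n}$, and a subfield $\mathbb K_0$ of $\mathbb K$, the subgeometry $\mathrm{Gr}_{n-1}(B_n^+(\mathbb K_0))$ of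 $\mathrm{Gr}_{n-1}(B_n^+(\mathbb K))$ has as its points the $(n-1)$-dimensional totally singular subspaces of $V$ that admit a basis of vectors whose coordinates with respect to $E$ all lie in $\mathbb K_0$. The geometry $\mathrm{Gr}_{n-1}(B_n^+(\mathbb K))$ is $\mathbb K_0$-generated if these points generate it. Corollary 1.2. Bases $E$ as above exist and, whichever such basis $E$ is chosen, $\mathrm{Gr}_{n-1}(B_n^+(\mathbb K))$ is not $\mathbb K_0$-generated for any proper subfield $\mathbb K_0$ of $\mathbb K$. -/

import Mathlib

/-- A point-line geometry on the point-set `P`; a line is identified with its set of points. -/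
structure PointLineGeometry (P : Type*) where
  lines : Set (Set P)

/-- A subspace: a set of points containing every line that has two distinct points in it. -/
def PointLineGeometry.IsSubspace {P : Type*} (Γ : PointLineGeometry P) (S : Set P) : Prop :=
  ∀ ℓ ∈ Γ.lines, ∀ x ∈ ℓ, ∀ y ∈ ℓ, x ≠ y → x ∈ S → y ∈ S → ℓ ⊆ S

/-- The subspace generated by a set of points: the intersection of all subspaces containing it. -/
def PointLineGeometry.generated {P : Type*} (Γ : PointLineGeometry P) (A : Set P) : Set P :=
  ⋂₀ {S | Γ.IsSubspace S ∧ A ⊆ S}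

section TopThin

variable {K V : Type*} [Field K] [AddCommGroup V] [Module K V]

/-- The subspace `X` is totally singular for the quadratic form `Q`. -/
def IsTotallySingular (Q : QuadraticForm K V) (X : Submodule K V) : Prop :=
  ∀ v ∈ X, Q v = 0

/-- The Witt index of `Q` is `n`: the largest dimension of a totally singular subspace. -/
def HasWittIndex (Q : QuadraticForm K V) (n : ℕ) : Prop :=
  IsGreatest {d : ℕ | ∃ X : Submodule K V, IsTotallySingular Q X ∧ Module.finrank K X = d} n

/-- The elements of type `k` of the polar space of `Q`: the totally singular subspaces of
vector-space dimension `k`. -/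
abbrev PolarElement (Q : QuadraticForm K V) (k : ℕ) : Type _ :=
  {X : Submodule K V // IsTotallySingular Q X ∧ Module.finrank K X = k}

/-- The line `{Y : X ⊆ Y ⊆ M}` of the `k`-Grassmannian attached to subspaces `X` and `M`. -/
def polarLine (Q : QuadraticForm K V) (k : ℕ) (X M : Submodule K V) : Set (PolarElement Q k) :=
  {Y | X ≤ Y.1 ∧ Y.1 ≤ M}

/-- The `k`-Grassmannian of the polar space of `Q`, for `1 ≤ k` smaller than the Witt index.
Its points are the elements of type `k`; its lines are given by the flags `X ⊂ M` of elements of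
type `k - 1` and `k + 1` (for `k = 1`, `X` is the zero subspace). -/
def polarGrassmannian (Q : QuadraticForm K V) (k : ℕ) : PointLineGeometry (PolarElement Q k) where
  lines := {ℓ | ∃ X M : Submodule K V, IsTotallySingular Q M ∧ X ≤ M ∧
    Module.finrank K X + 1 = k ∧ Module.finrank K M = k + 1 ∧ ℓ = polarLine Q k X M}

/-- With respect to the basis `E`, the form `Q` has the canonical expression
`x₁ x₂ + x₃ x₄ + ⋯ + x₂ₙ₋₁ x₂ₙ`; the pair `(i, 0)`, `(i, 1)` indexes the `i`-th summand. -/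
def IsHyperbolicBasis {n : ℕ} (Q : QuadraticForm K V) (E : Module.Basis (Fin n × Fin 2) K V) :
    Prop :=
  ∀ v : V, Q v = ∑ i : Fin n, E.repr v (i, 0) * E.repr v (i, 1)

/-- A vector is `K₀`-rational with respect to `E` if its coordinates lie in `K₀`. -/
def IsRationalVector {ι : Type*} (E : Module.Basis ι K V) (K₀ : Subfield K) (v : V) : Prop :=
  ∀ i, E.repr v i ∈ K₀

/-- A subspace is `K₀`-rational with respect to `E` if it has a basis of `K₀`-rational vectors. -/
def IsRationalSubspace {ι : Type*} (E : Module.Basis ι K V) (K₀ : Subfield K)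
    (X : Submodule K V) : Prop :=
  ∃ b : Module.Basis (Fin (Module.finrank K X)) K X, ∀ i, IsRationalVector E K₀ (b i : V)

/-- The points of the `K₀`-rational subgeometry of the `k`-Grassmannian, that is of the
`k`-Grassmannian of the polar space over `K₀` embedded in that over `K` through `E`. -/
def rationalPoints {ι : Type*} (Q : QuadraticForm K V) (k : ℕ) (E : Module.Basis ι K V)
    (K₀ : Subfield K) : Set (PolarElement Q k) :=
  {X | IsRationalSubspace E K₀ X.1}

/-- The `k`-Grassmannian of the polar space of `Q` is generated over `K₀`, the subgeometry over
`K₀` being the one determined by the basis `E`. -/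
def IsGeneratedOver {ι : Type*} (Q : QuadraticForm K V) (k : ℕ) (E : Module.Basis ι K V)
    (K₀ : Subfield K) : Prop :=
  (polarGrassmannian Q k).generated (rationalPoints Q k E K₀) = Set.univ

end TopThin

/-! ### Orthogonality, totally singular subspaces and hyperbolic bases. -/

section QuadraticSpace

open QuadraticMap Module

variable {K V : Type*} [Field K] [AddCommGroup V] [Module K V]

/-! The rational points are trapped in a proper subspace of the geometry, `nearStable`: the points
that contain a K₀-rational subspace of dimension n - 2 or lie in a K₀-rational maximal totally
singular subspace. Every rational point is there because a rational totally singular subspace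
extends to a rational maximal one (`exists_stable_maximal`). If a line given by X ⊂ M has two points
in the set, then X or M is rational, so the whole line is in it (`isSubspace_nearStable`). This uses
that sums, intersections and orthogonals of rational subspaces are rational, and that a maximal
totally singular subspace through a rational hyperplane of itself is rational
(`isStable_of_hyperplane`). The set is proper: write e_i, f_i for the hyperbolic pairs and take a ∉
K₀. The span of a e₀ + f₁, -a e₁ + f₀ and n - 3 further e_i is a point outside it
(`exists_notMem_nearStable`). Rationality is used as stability under coordinatewise K₀-linear maps K
→ K₀, which passes to sums and intersections at once. -/

/-- The orthogonal of `X` for the polar form of `Q`. -/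
def polarPerp (Q : QuadraticForm K V) (X : Submodule K V) : Submodule K V :=
  LinearMap.BilinForm.orthogonal Q.polarBilin X

theorem mem_polarPerp {Q : QuadraticForm K V} {X : Submodule K V} {v : V} :
    v ∈ polarPerp Q X ↔ ∀ x ∈ X, polar Q x v = 0 := Iff.rfl

theorem polarPerp_anti (Q : QuadraticForm K V) {X Y : Submodule K V} (h : X ≤ Y) :
    polarPerp Q Y ≤ polarPerp Q X := fun _ hv x hx => hv x (h hx)

theorem polarPerp_sup (Q : QuadraticForm K V) (X Y : Submodule K V) :
    polarPerp Q (X ⊔ Y) = polarPerp Q X ⊓ polarPerp Q Y := by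
  apply le_antisymm
  · exact le_inf (polarPerp_anti Q le_sup_left) (polarPerp_anti Q le_sup_right)
  · rintro v ⟨h1, h2⟩ z hz
    obtain ⟨x, hx, y, hy, rfl⟩ := Submodule.mem_sup.1 hz
    have e1 := mem_polarPerp.1 h1 x hx
    have e2 := mem_polarPerp.1 h2 y hy
    simp [e1, e2]

theorem IsTotallySingular.mono {Q : QuadraticForm K V} {X Y : Submodule K V}
    (hY : IsTotallySingular Q Y) (h : X ≤ Y) : IsTotallySingular Q X := fun v hv => hY v (h hv)

theorem IsTotallySingular.polar_eq_zero {Q : QuadraticForm K V} {X : Submodule K V}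
    (hX : IsTotallySingular Q X) {x y : V} (hx : x ∈ X) (hy : y ∈ X) : polar Q x y = 0 := by
  simp [polar, hX _ (X.add_mem hx hy), hX _ hx, hX _ hy]

theorem IsTotallySingular.le_polarPerp {Q : QuadraticForm K V} {X : Submodule K V}
    (hX : IsTotallySingular Q X) : X ≤ polarPerp Q X :=
  fun _ hv _ hx => hX.polar_eq_zero hx hv

theorem IsTotallySingular.sup {Q : QuadraticForm K V} {X Y : Submodule K V}
    (hX : IsTotallySingular Q X) (hY : IsTotallySingular Q Y) (h : Y ≤ polarPerp Q X) :
    IsTotallySingular Q (X ⊔ Y) := by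
  intro z hz
  obtain ⟨x, hx, y, hy, rfl⟩ := Submodule.mem_sup.1 hz
  rw [QuadraticMap.map_add Q, hX x hx, hY y hy, mem_polarPerp.1 (h hy) x hx]
  simp

theorem isTotallySingular_span_range {ι : Type*} [Fintype ι] {Q : QuadraticForm K V} {g : ι → V}
    (h0 : ∀ i, Q (g i) = 0) (h1 : ∀ i j, i ≠ j → polar Q (g i) (g j) = 0) :
    IsTotallySingular Q (Submodule.span K (Set.range g)) := by
  classical
  intro v hv
  obtain ⟨c, rfl⟩ := (Submodule.mem_span_range_iff_exists_fun K).1 hv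
  have : ∀ s : Finset ι, Q (∑ i ∈ s, c i • g i) = 0 := by
    intro s
    induction s using Finset.induction_on with
    | empty => simp
    | insert a s ha ih =>
      rw [Finset.sum_insert ha, QuadraticMap.map_add Q, ih, QuadraticMap.map_smul, h0,
        ← polarBilin_apply_apply, map_sum, Finset.sum_eq_zero]
      · simp
      · intro i hi
        have hia : a ≠ i := fun e => ha (e ▸ hi)
        simp [h1 a i hia]
  exact this _

theorem HasWittIndex.finrank_le {Q : QuadraticForm K V} {n : ℕ} (hW : HasWittIndex Q n)
    {X : Submodule K V} (hX : IsTotallySingular Q X) : finrank K X ≤ n := hW.2 ⟨X, hX, rfl⟩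

theorem HasWittIndex.eq_of_le [FiniteDimensional K V] {Q : QuadraticForm K V} {n : ℕ}
    (hW : HasWittIndex Q n) {X Y : Submodule K V} (hX : finrank K X = n)
    (hY : IsTotallySingular Q Y) (h : X ≤ Y) : X = Y :=
  Submodule.eq_of_le_of_finrank_le h (hX ▸ hW.finrank_le hY)

/-- For a non-degenerate form, every basis of a totally singular subspace has a dual system in the
whole space. -/
theorem exists_polar_dual_family [FiniteDimensional K V] {Q : QuadraticForm K V}
    (hQ : Q.radical = ⊥) {X : Submodule K V} (hX : IsTotallySingular Q X) {ι : Type*}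
    [DecidableEq ι] (b : Basis ι K X) :
    ∃ g : ι → V, ∀ i j, polar Q (b i : V) (g j) = if i = j then 1 else 0 := by
  -- Injectivity of X → V* holds because its kernel consists of singular vectors orthogonal to V.
  -- Dually V → X* is onto, so the coordinate functionals of `b` are represented by vectors.
  let B : X →ₗ[K] V →ₗ[K] K := Q.polarBilin.domRestrict X
  have hB : Function.Injective B := by
    rw [← LinearMap.ker_eq_bot, LinearMap.ker_eq_bot']
    intro x hx
    have : (x : V) ∈ Q.radical := ⟨hX x x.2, hx⟩
    rw [hQ] at this
    exact Subtype.ext this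
  have hs := LinearMap.flip_surjective_iff₁.2 hB
  choose g hg using fun j => hs (b.coord j)
  refine ⟨g, fun i j => ?_⟩
  have := LinearMap.congr_fun (hg j) (b i)
  rw [Basis.coord_apply, Basis.repr_self, Finsupp.single_apply] at this
  exact this

/-- A dual system of a totally singular family can be corrected to consist of pairwise orthogonal
singular vectors. -/
theorem exists_singular_dual_family {Q : QuadraticForm K V} {n : ℕ} {f g : Fin n → V}
    (hf : IsTotallySingular Q (Submodule.span K (Set.range f)))
    (hfg : ∀ i j, polar Q (f i) (g j) = if i = j then 1 else 0) :
    ∃ g' : Fin n → V, (∀ i j, polar Q (f i) (g' j) = if i = j then 1 else 0) ∧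
      (∀ i, Q (g' i) = 0) ∧ ∀ i j, i ≠ j → polar Q (g' i) (g' j) = 0 := by
  -- Adding `h i` changes `Q (g i)` by `c i i` and `polar Q (g i) (g j)` by `c i j + c j i`. A
  -- triangular choice cancels each value once, without dividing by 2, so characteristic 2 is
  -- covered.
  let c : Fin n → Fin n → K := fun i j =>
    if i = j then -Q (g i) else if i < j then -polar Q (g i) (g j) else 0
  let h : Fin n → V := fun i => ∑ k, c i k • f k
  have hmem : ∀ i, h i ∈ Submodule.span K (Set.range f) := fun i =>
    Submodule.sum_mem _ fun k _ => Submodule.smul_mem _ _ (Submodule.subset_span ⟨k, rfl⟩)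
  have hfmem : ∀ i, f i ∈ Submodule.span K (Set.range f) := fun i => Submodule.subset_span ⟨i, rfl⟩
  have hhg : ∀ i j, polar Q (h i) (g j) = c i j := by
    intro i j
    rw [← polarBilin_apply_apply]
    simp [h, map_sum, LinearMap.sum_apply, hfg]
  refine ⟨fun i => g i + h i, fun i j => ?_, fun i => ?_, fun i j hij => ?_⟩
  · rw [polar_add_right, hfg, hf.polar_eq_zero (hfmem i) (hmem j), add_zero]
  · rw [QuadraticMap.map_add Q, hf _ (hmem i), polar_comm, hhg]
    simp [c]
  · rw [polar_add_right, polar_add_left, polar_add_left, hhg, polar_comm Q (g i) (h j), hhg,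
      hf.polar_eq_zero (hmem i) (hmem j)]
    rcases lt_or_gt_of_ne hij with hlt | hlt
    · simp [c, hij, hij.symm, hlt, hlt.not_gt]
    · simp [c, hij, hij.symm, hlt, hlt.not_gt, polar_comm Q (g i) (g j)]

/-- A non-degenerate quadratic form of Witt index `n` in dimension `2 * n` is hyperbolic. -/
theorem exists_isHyperbolicBasis [FiniteDimensional K V] {n : ℕ} (hV : finrank K V = 2 * n)
    {Q : QuadraticForm K V} (hQ : Q.radical = ⊥) (hW : HasWittIndex Q n) :
    ∃ E : Basis (Fin n × Fin 2) K V, IsHyperbolicBasis Q E := by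
  obtain ⟨X, hX, hXn⟩ := hW.1
  let b := finBasisOfFinrankEq K X hXn
  obtain ⟨g₀, hg₀⟩ := exists_polar_dual_family hQ hX b
  let f : Fin n → V := fun i => b i
  have hf : IsTotallySingular Q (Submodule.span K (Set.range f)) := by
    refine hX.mono (Submodule.span_le.2 ?_)
    rintro _ ⟨i, rfl⟩
    exact (b i).2
  obtain ⟨g, hfg, hg0, hg1⟩ := exists_singular_dual_family (f := f) hf hg₀
  have hg := isTotallySingular_span_range hg0 hg1
  have hfmem : ∀ i, f i ∈ Submodule.span K (Set.range f) := fun i => Submodule.subset_span ⟨i, rfl⟩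
  have hgmem : ∀ i, g i ∈ Submodule.span K (Set.range g) := fun i => Submodule.subset_span ⟨i, rfl⟩
  let e : Fin n × Fin 2 → V := fun p => if p.2 = 0 then f p.1 else g p.1
  -- Each coordinate is read off by pairing with the opposite member of its hyperbolic pair.
  let L : V →ₗ[K] (Fin n × Fin 2 → K) := LinearMap.pi fun p =>
    if p.2 = 0 then Q.polarBilin (g p.1) else Q.polarBilin (f p.1)
  have hL : ∀ p, L (e p) = Pi.single p 1 := by
    rintro ⟨i, s⟩
    ext ⟨j, t⟩
    fin_cases s <;> fin_cases t <;>
      simp [L, e, Pi.single_apply, hfg, hf.polar_eq_zero (hfmem _) (hfmem _),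
        hg.polar_eq_zero (hgmem _) (hgmem _), polar_comm Q (g j) (f i), eq_comm]
  have hli : LinearIndependent K e := by
    refine LinearIndependent.of_comp L ?_
    have : L ∘ e = Pi.basisFun K (Fin n × Fin 2) := by
      ext p
      simp [hL]
    rw [this]
    exact (Pi.basisFun K (Fin n × Fin 2)).linearIndependent
  have hcard : Fintype.card (Fin n × Fin 2) = finrank K V := by simp [hV, mul_comm]
  rcases Nat.eq_zero_or_pos n with rfl | hn
  · have h0 : finrank K V = 0 := by simpa using hV
    have := finrank_zero_iff.1 h0
    exact ⟨Basis.empty V, fun v => by simp [Subsingleton.elim v 0]⟩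
  have : Nonempty (Fin n × Fin 2) := ⟨(⟨0, hn⟩, 0)⟩
  let E := basisOfLinearIndependentOfCardEqFinrank hli hcard
  refine ⟨E, fun v => ?_⟩
  have hv : v = ∑ i, E.repr v (i, 0) • f i + ∑ i, E.repr v (i, 1) • g i := by
    conv_lhs => rw [← E.sum_repr v, Fintype.sum_prod_type]
    simp [E, e, Fin.sum_univ_two, Finset.sum_add_distrib]
  conv_lhs => rw [hv]
  rw [QuadraticMap.map_add Q,
    hf _ (Submodule.sum_mem _ fun i _ => Submodule.smul_mem _ _ (hfmem i)),
    hg _ (Submodule.sum_mem _ fun i _ => Submodule.smul_mem _ _ (hgmem i)),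
    ← polarBilin_apply_apply]
  simp [map_sum, LinearMap.sum_apply, hfg, mul_comm]

/-! ### The polar form in hyperbolic coordinates. -/

variable {n : ℕ} {Q : QuadraticForm K V} {E : Basis (Fin n × Fin 2) K V}

theorem IsHyperbolicBasis.polar_eq (hE : IsHyperbolicBasis Q E) (v w : V) :
    polar Q v w = ∑ i, (E.repr v (i, 0) * E.repr w (i, 1) + E.repr v (i, 1) * E.repr w (i, 0)) := by
  simp only [polar, hE _, ← Finset.sum_sub_distrib]
  refine Finset.sum_congr rfl fun i _ => ?_
  simp only [map_add, Finsupp.add_apply]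
  ring

theorem IsHyperbolicBasis.polar_self_zero (hE : IsHyperbolicBasis Q E) (i : Fin n) (v : V) :
    polar Q (E (i, 0)) v = E.repr v (i, 1) := by
  classical
  simp [hE.polar_eq, Finsupp.single_apply]

theorem IsHyperbolicBasis.polar_self_one (hE : IsHyperbolicBasis Q E) (i : Fin n) (v : V) :
    polar Q (E (i, 1)) v = E.repr v (i, 0) := by
  classical
  simp [hE.polar_eq, Finsupp.single_apply]

theorem IsHyperbolicBasis.finrank_add_finrank_polarPerp (hE : IsHyperbolicBasis Q E)
    (X : Submodule K V) : finrank K X + finrank K (polarPerp Q X) = 2 * n := by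
  have : FiniteDimensional K V := E.finiteDimensional_of_finite
  have hker : LinearMap.ker Q.polarBilin = ⊥ := by
    rw [LinearMap.ker_eq_bot']
    intro v hv
    have h : ∀ w, polar Q w v = 0 := fun w => by
      rw [polar_comm]
      exact LinearMap.congr_fun hv w
    refine E.ext_elem fun ⟨i, s⟩ => ?_
    fin_cases s
    · simpa using (hE.polar_self_one i v).symm.trans (h _)
    · simpa using (hE.polar_self_zero i v).symm.trans (h _)
  have := LinearMap.BilinForm.finrank_add_finrank_orthogonal' (B := Q.polarBilin) X
  rw [hker, inf_bot_eq, finrank_bot, finrank_eq_card_basis E] at this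
  rw [polarPerp, this]
  simp [mul_comm]

theorem IsHyperbolicBasis.polarPerp_eq_self (hE : IsHyperbolicBasis Q E) {M : Submodule K V}
    (hM : IsTotallySingular Q M) (hMn : finrank K M = n) : polarPerp Q M = M := by
  have : FiniteDimensional K V := E.finiteDimensional_of_finite
  refine (Submodule.eq_of_le_of_finrank_le hM.le_polarPerp ?_).symm
  have := hE.finrank_add_finrank_polarPerp M
  omega

end QuadraticSpace

/-! ### Rational subspaces through coordinatewise linear maps. -/

section Stable

open Module

variable {K V ι : Type*} [Field K] [AddCommGroup V] [Module K V] [Fintype ι]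

/-- The `K₀`-linear map applying `l` to every coordinate with respect to `E`. -/
noncomputable def coordMap (E : Basis ι K V) {K₀ : Subfield K} (l : K →ₗ[K₀] K₀) (v : V) : V :=
  ∑ i, (l (E.repr v i) : K) • E i

/-- Stability under all coordinatewise `K₀`-linear maps to `K₀`: the coordinate characterization of
the subspaces spanned by `K₀`-rational vectors. -/
def IsStable (E : Basis ι K V) (K₀ : Subfield K) (X : Submodule K V) : Prop :=
  ∀ l : K →ₗ[K₀] K₀, ∀ v ∈ X, coordMap E l v ∈ X

variable {E : Basis ι K V} {K₀ : Subfield K}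

theorem repr_coordMap (l : K →ₗ[K₀] K₀) (v : V) (i : ι) :
    E.repr (coordMap E l v) i = l (E.repr v i) := by
  classical
  simp [coordMap, Finsupp.single_apply]

theorem isRationalVector_coordMap (l : K →ₗ[K₀] K₀) (v : V) :
    IsRationalVector E K₀ (coordMap E l v) := fun i => by
  rw [repr_coordMap]
  exact (l _).2

theorem coordMap_add (l : K →ₗ[K₀] K₀) (v w : V) :
    coordMap E l (v + w) = coordMap E l v + coordMap E l w := by
  simp [coordMap, add_smul, Finset.sum_add_distrib]

theorem subfield_map_mul (l : K →ₗ[K₀] K₀) (c : K) {r : K} (hr : r ∈ K₀) :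
    (l (c * r) : K) = l c * r := by
  have := l.map_smul ⟨r, hr⟩ c
  rw [Subfield.smul_def, smul_eq_mul, smul_eq_mul, mul_comm] at this
  rw [this, mul_comm]
  simp

theorem coordMap_smul (l : K →ₗ[K₀] K₀) (c : K) {r : V} (hr : IsRationalVector E K₀ r) :
    coordMap E l (c • r) = (l c : K) • r := by
  refine E.ext_elem fun i => ?_
  rw [repr_coordMap]
  simp [subfield_map_mul l c (hr i)]

theorem IsStable.inf {X Y : Submodule K V} (hX : IsStable E K₀ X) (hY : IsStable E K₀ Y) :
    IsStable E K₀ (X ⊓ Y) := fun l v hv => ⟨hX l v hv.1, hY l v hv.2⟩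

theorem IsStable.sup {X Y : Submodule K V} (hX : IsStable E K₀ X) (hY : IsStable E K₀ Y) :
    IsStable E K₀ (X ⊔ Y) := by
  intro l v hv
  obtain ⟨x, hx, y, hy, rfl⟩ := Submodule.mem_sup.1 hv
  rw [coordMap_add]
  exact Submodule.add_mem_sup (hX l x hx) (hY l y hy)

theorem isStable_span {s : Set V} (hs : ∀ v ∈ s, IsRationalVector E K₀ v) :
    IsStable E K₀ (Submodule.span K s) := by
  intro l v hv
  induction hv using Submodule.closure_induction with
  | zero => simp [coordMap]
  | add x y _ _ hx hy => rw [coordMap_add]; exact Submodule.add_mem _ hx hy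
  | smul_mem c x hx =>
    rw [coordMap_smul l c (hs x hx)]
    exact Submodule.smul_mem _ _ (Submodule.subset_span hx)

theorem IsRationalSubspace.isStable {X : Submodule K V} (hX : IsRationalSubspace E K₀ X) :
    IsStable E K₀ X := by
  obtain ⟨b, hb⟩ := hX
  have : X = Submodule.span K (Set.range fun i => (b i : V)) := by
    have h := congrArg (Submodule.map X.subtype) b.span_eq
    rw [Submodule.map_span, Submodule.map_subtype_top, ← Set.range_comp] at h
    exact h.symm
  rw [this]
  refine isStable_span ?_
  rintro _ ⟨i, rfl⟩
  exact hb i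

/-- Expanding all coordinates of v in a K₀-basis (b_j) of K gives v = ∑ b_j v_j, where v_j collects
the j-th coefficients. Each v_j is rational, and stability puts it in X. -/
theorem IsStable.le_span_rational {X : Submodule K V} (hX : IsStable E K₀ X) :
    X ≤ Submodule.span K {r | r ∈ X ∧ IsRationalVector E K₀ r} := by
  classical
  intro v hv
  let b := Basis.ofVectorSpace K₀ K
  let J := Finset.univ.biUnion fun i => (b.repr (E.repr v i)).support
  have hc : ∀ i, E.repr v i = ∑ j ∈ J, b j * (b.coord j (E.repr v i) : K) := by
    intro i
    conv_lhs => rw [← b.linearCombination_repr (E.repr v i)]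
    rw [Finsupp.linearCombination_apply, Finsupp.sum_of_support_subset (s := J)]
    · simp [Subfield.smul_def, mul_comm]
    · exact Finset.subset_biUnion_of_mem (fun i => (b.repr (E.repr v i)).support)
        (Finset.mem_univ i)
    · simp
  have hv' : v = ∑ j ∈ J, b j • coordMap E (b.coord j) v := by
    refine E.ext_elem fun i => ?_
    rw [hc i]
    simp only [map_sum, map_smul, Finsupp.coe_finsetSum, Finset.sum_apply, Finsupp.smul_apply,
      repr_coordMap, smul_eq_mul]
  rw [hv']
  exact Submodule.sum_mem _ fun j _ => Submodule.smul_mem _ _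
    (Submodule.subset_span ⟨hX _ v hv, isRationalVector_coordMap _ v⟩)

theorem IsStable.exists_rational_notMem {X Y : Submodule K V} (hX : IsStable E K₀ X)
    (h : ¬ X ≤ Y) : ∃ r ∈ X, IsRationalVector E K₀ r ∧ r ∉ Y := by
  by_contra! hc
  exact h (hX.le_span_rational.trans (Submodule.span_le.2 fun r hr => hc r hr.1 hr.2))

end Stable

/-! ### Sums and intersections in codimension one. -/

section Hyperplanes

open Module

variable {K V : Type*} [Field K] [AddCommGroup V] [Module K V] [FiniteDimensional K V]
  {A B C : Submodule K V}

theorem sup_eq_of_finrank_add_one (h : finrank K A + 1 = finrank K C) (hA : A ≤ C) (hB : B ≤ C)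
    (hBA : ¬ B ≤ A) : A ⊔ B = C := by
  refine Submodule.eq_of_le_of_finrank_le (sup_le hA hB) ?_
  have := Submodule.finrank_lt_finrank_of_lt (left_lt_sup.2 hBA)
  omega

theorem inf_eq_of_finrank_add_one (h : finrank K A + 1 = finrank K C) (hA : A ≤ C) (hB : A ≤ B)
    (hCB : ¬ C ≤ B) : C ⊓ B = A := by
  refine (Submodule.eq_of_le_of_finrank_le (le_inf hA hB) ?_).symm
  have := Submodule.finrank_lt_finrank_of_lt (inf_lt_left.2 hCB)
  omega

theorem not_le_of_finrank_eq (h : finrank K A = finrank K B) (hne : A ≠ B) : ¬ A ≤ B :=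
  fun hle => hne (Submodule.eq_of_le_of_finrank_le hle h.ge)

end Hyperplanes

/-! ### Rational totally singular subspaces. -/

section StablePolar

open QuadraticMap Module

variable {K V : Type*} [Field K] [AddCommGroup V] [Module K V] {n : ℕ} {Q : QuadraticForm K V}
  {E : Basis (Fin n × Fin 2) K V} {K₀ : Subfield K}

/-- M₁ ∩ M₂ is orthogonal to Y₁ + Y₂ = M, hence contained in M by maximality. It therefore equals
(M₁ ∩ M) ∩ (M₂ ∩ M) = Y₁ ∩ Y₂ = X. -/
theorem HasWittIndex.inf_eq_of_adjacent [FiniteDimensional K V] (hW : HasWittIndex Q n)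
    {X Y₁ Y₂ M M₁ M₂ : Submodule K V} (hM : IsTotallySingular Q M) (hMn : finrank K M = n)
    (hM₁ : IsTotallySingular Q M₁) (hM₁n : finrank K M₁ = n)
    (hM₂ : IsTotallySingular Q M₂) (hM₂n : finrank K M₂ = n)
    (hY₁n : finrank K Y₁ + 1 = n) (hY₂n : finrank K Y₂ + 1 = n) (hXn : finrank K X + 2 = n)
    (hXY₁ : X ≤ Y₁) (hXY₂ : X ≤ Y₂) (hY₁ : Y₁ ≤ M) (hY₂ : Y₂ ≤ M) (hY₁M₁ : Y₁ ≤ M₁)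
    (hY₂M₂ : Y₂ ≤ M₂) (hne₁ : M₁ ≠ M) (hne₂ : M₂ ≠ M) (hY : Y₁ ≠ Y₂) : M₁ ⊓ M₂ = X := by
  have hsup : Y₁ ⊔ Y₂ = M := sup_eq_of_finrank_add_one (by omega) hY₁ hY₂
    (not_le_of_finrank_eq (by omega) hY.symm)
  have hT : M₁ ⊓ M₂ ≤ M := by
    have hTS : IsTotallySingular Q (M ⊔ M₁ ⊓ M₂) := by
      refine hM.sup (hM₁.mono inf_le_left) ?_
      rw [← hsup, polarPerp_sup]
      exact inf_le_inf (hM₁.le_polarPerp.trans (polarPerp_anti Q hY₁M₁))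
        (hM₂.le_polarPerp.trans (polarPerp_anti Q hY₂M₂))
    exact (hW.eq_of_le hMn hTS le_sup_left) ▸ le_sup_right
  have e₁ : M₁ ⊓ M = Y₁ := inf_eq_of_finrank_add_one (by omega) hY₁M₁ hY₁
    (not_le_of_finrank_eq (by omega) hne₁)
  have e₂ : M₂ ⊓ M = Y₂ := inf_eq_of_finrank_add_one (by omega) hY₂M₂ hY₂
    (not_le_of_finrank_eq (by omega) hne₂)
  have e : Y₁ ⊓ Y₂ = X := inf_eq_of_finrank_add_one (by omega) hXY₁ hXY₂
    (not_le_of_finrank_eq (by omega) hY)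
  refine le_antisymm ?_ (le_inf (hXY₁.trans hY₁M₁) (hXY₂.trans hY₂M₂))
  rw [← e, ← e₁, ← e₂]
  exact le_inf (le_inf inf_le_left hT) (le_inf inf_le_right hT)

theorem isRationalVector_basis (p : Fin n × Fin 2) : IsRationalVector E K₀ (E p) := by
  classical
  intro i
  rw [Basis.repr_self, Finsupp.single_apply]
  split_ifs
  exacts [K₀.one_mem, K₀.zero_mem]

/-- Pairing with a rational vector is a linear form with coefficients in K₀, so it commutes with
`l`. -/
theorem IsHyperbolicBasis.polar_coordMap (hE : IsHyperbolicBasis Q E) (l : K →ₗ[K₀] K₀) {r : V}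
    (hr : IsRationalVector E K₀ r) (v : V) : polar Q r (coordMap E l v) = l (polar Q r v) := by
  rw [hE.polar_eq, hE.polar_eq, map_sum, AddSubmonoidClass.coe_finsetSum]
  refine Finset.sum_congr rfl fun i _ => ?_
  rw [repr_coordMap, repr_coordMap, map_add, mul_comm (E.repr r (i, 0)) (E.repr v (i, 1)),
    mul_comm (E.repr r (i, 1)) (E.repr v (i, 0)), Subfield.coe_add, subfield_map_mul l _ (hr _),
    subfield_map_mul l _ (hr _), mul_comm, mul_comm (E.repr r (i, 1))]

theorem IsHyperbolicBasis.polar_mem (hE : IsHyperbolicBasis Q E) {v w : V}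
    (hv : IsRationalVector E K₀ v) (hw : IsRationalVector E K₀ w) : polar Q v w ∈ K₀ := by
  rw [hE.polar_eq]
  exact sum_mem fun i _ => add_mem (mul_mem (hv _) (hw _)) (mul_mem (hv _) (hw _))

theorem IsHyperbolicBasis.apply_mem (hE : IsHyperbolicBasis Q E) {v : V}
    (hv : IsRationalVector E K₀ v) : Q v ∈ K₀ := by
  rw [hE]
  exact sum_mem fun i _ => mul_mem (hv _) (hv _)

theorem IsHyperbolicBasis.isStable_polarPerp (hE : IsHyperbolicBasis Q E) {X : Submodule K V}
    (hX : IsStable E K₀ X) : IsStable E K₀ (polarPerp Q X) := by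
  intro l v hv
  have hle : X ≤ LinearMap.ker (Q.polarBilin.flip (coordMap E l v)) := by
    refine hX.le_span_rational.trans (Submodule.span_le.2 ?_)
    rintro r ⟨hr, hr'⟩
    change polar Q r (coordMap E l v) = 0
    rw [hE.polar_coordMap l hr', mem_polarPerp.1 hv r hr, map_zero, Subfield.coe_zero]
  exact fun x hx => hle hx

/-- The projection of a stable maximal totally singular subspace to a stable totally singular
subspace `Z` is a stable maximal totally singular subspace through `Z`. -/
theorem IsHyperbolicBasis.stable_projection (hE : IsHyperbolicBasis Q E) (hW : HasWittIndex Q n)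
    {F Z : Submodule K V} (hF : IsTotallySingular Q F) (hFn : finrank K F = n)
    (hFs : IsStable E K₀ F) (hZ : IsTotallySingular Q Z) (hZs : IsStable E K₀ Z) :
    IsTotallySingular Q (Z ⊔ F ⊓ polarPerp Q Z) ∧ IsStable E K₀ (Z ⊔ F ⊓ polarPerp Q Z) ∧
      finrank K ↥(Z ⊔ F ⊓ polarPerp Q Z) = n := by
  have : FiniteDimensional K V := E.finiteDimensional_of_finite
  have hTS : IsTotallySingular Q (Z ⊔ F ⊓ polarPerp Q Z) :=
    hZ.sup (hF.mono inf_le_left) inf_le_right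
  refine ⟨hTS, hZs.sup (hFs.inf (hE.isStable_polarPerp hZs)), ?_⟩
  refine le_antisymm (hW.finrank_le hTS) ?_
  -- As F is its own orthogonal, F ∩ Z^⊥ = (F + Z)^⊥ has dimension n - dim Z + dim (F ∩ Z). Its
  -- intersection with Z lies in F ∩ Z, so the sum with Z has dimension at least n.
  have h1 := hE.finrank_add_finrank_polarPerp (F ⊔ Z)
  rw [polarPerp_sup, hE.polarPerp_eq_self hF hFn] at h1
  have h2 := Submodule.finrank_sup_add_finrank_inf_eq F Z
  have h3 := Submodule.finrank_sup_add_finrank_inf_eq Z (F ⊓ polarPerp Q Z)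
  have h4 : finrank K ↥(Z ⊓ (F ⊓ polarPerp Q Z)) ≤ finrank K ↥(F ⊓ Z) :=
    Submodule.finrank_mono (le_inf (inf_le_right.trans inf_le_left) inf_le_left)
  omega

theorem IsHyperbolicBasis.exists_stable_maximal (hE : IsHyperbolicBasis Q E)
    (hW : HasWittIndex Q n) {Z : Submodule K V} (hZ : IsTotallySingular Q Z)
    (hZs : IsStable E K₀ Z) :
    ∃ N, IsTotallySingular Q N ∧ IsStable E K₀ N ∧ finrank K N = n ∧ Z ≤ N := by
  classical
  -- One rational maximal subspace suffices: its projection to `Z` is the required one.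
  let f : Fin n → V := fun i => E (i, 0)
  have hF : IsTotallySingular Q (Submodule.span K (Set.range f)) := by
    refine isTotallySingular_span_range (fun i => ?_) fun i j _ => ?_
    · simp [hE (f i), f, Finsupp.single_apply]
    · simp [f, hE.polar_self_zero]
  have hFn : finrank K (Submodule.span K (Set.range f)) = n := by
    rw [finrank_span_eq_card, Fintype.card_fin]
    exact E.linearIndependent.comp (fun i : Fin n => (i, (0 : Fin 2)))
      (fun i j h => congrArg Prod.fst h)
  have hFs : IsStable E K₀ (Submodule.span K (Set.range f)) := by
    refine isStable_span ?_
    rintro _ ⟨i, rfl⟩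
    exact isRationalVector_basis _
  obtain ⟨h1, h2, h3⟩ := hE.stable_projection hW hF hFn hFs hZ hZs
  exact ⟨_, h1, h2, h3, le_sup_left⟩

/-- Both maximal totally singular subspaces through a stable totally singular subspace of
codimension one are stable. -/
theorem IsHyperbolicBasis.isStable_of_hyperplane (hE : IsHyperbolicBasis Q E)
    (hW : HasWittIndex Q n) {Y M : Submodule K V} (hYs : IsStable E K₀ Y)
    (hYn : finrank K Y + 1 = n) (hM : IsTotallySingular Q M) (hMn : finrank K M = n)
    (hYM : Y ≤ M) : IsStable E K₀ M := by
  have : FiniteDimensional K V := E.finiteDimensional_of_finite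
  have hY : IsTotallySingular Q Y := hM.mono hYM
  obtain ⟨N, hN, hNs, hNn, hYN⟩ := hE.exists_stable_maximal hW hY hYs
  -- Otherwise Y^⊥/Y is a hyperbolic plane whose two singular lines are N/Y and M/Y. One being
  -- rational, the other is found by solving a linear equation over K₀.
  by_cases hMN : M = N
  · exact hMN ▸ hNs
  have hMN' : ¬ M ≤ N := not_le_of_finrank_eq (by omega) hMN
  obtain ⟨e, heN, her, heY⟩ := hNs.exists_rational_notMem (Y := Y) fun h => by
    have := Submodule.finrank_mono h
    omega
  obtain ⟨w, hwY, hwr, hwN⟩ := (hE.isStable_polarPerp hYs).exists_rational_notMem (Y := N)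
    fun h => hMN' ((hM.le_polarPerp.trans (polarPerp_anti Q hYM)).trans h)
  have hYe : Y ⊔ K ∙ e = N := sup_eq_of_finrank_add_one (by omega) hYN
    ((Submodule.span_singleton_le_iff_mem _ _).2 heN)
    (fun h => heY ((Submodule.span_singleton_le_iff_mem _ _).1 h))
  have hwe : polar Q w e ≠ 0 := by
    intro h0
    apply hwN
    rw [← hE.polarPerp_eq_self hN hNn, ← hYe, polarPerp_sup]
    refine ⟨hwY, fun x hx => ?_⟩
    obtain ⟨c, rfl⟩ := Submodule.mem_span_singleton.1 hx
    change polar Q (c • e) w = 0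
    rw [polar_smul_left, polar_comm, h0, smul_zero]
  -- Since `Q e = 0`, the equation `Q (w + c • e) = 0` is linear in `c`.
  let c := -(Q w / polar Q w e)
  have hc : c ∈ K₀ := neg_mem (div_mem (hE.apply_mem hwr) (hE.polar_mem hwr her))
  let u := w + c • e
  have hur : IsRationalVector E K₀ u := fun i => by
    simpa [u] using add_mem (hwr i) (mul_mem hc (her i))
  have huN : u ∉ N := fun h => hwN ((N.add_mem_iff_left (N.smul_mem c heN)).1 h)
  have hu0 : Q u = 0 := by
    rw [QuadraticMap.map_add Q, QuadraticMap.map_smul, hN e heN, polar_smul_right]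
    simp only [c, smul_eq_mul]
    field_simp
    ring
  have huY : u ∈ polarPerp Q Y :=
    add_mem hwY (Submodule.smul_mem _ _ (polarPerp_anti Q hYN (hN.le_polarPerp heN)))
  have hperp : N ⊔ M = polarPerp Q Y := by
    refine sup_eq_of_finrank_add_one ?_ (hN.le_polarPerp.trans (polarPerp_anti Q hYN))
      (hM.le_polarPerp.trans (polarPerp_anti Q hYM)) hMN'
    have := hE.finrank_add_finrank_polarPerp Y
    omega
  rw [← hperp] at huY
  obtain ⟨x, hx, m, hm, hxm⟩ := Submodule.mem_sup.1 huY
  have hmY : m ∉ Y := fun h => huN (hxm ▸ N.add_mem hx (hYN h))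
  have hYm : Y ⊔ K ∙ m = M := sup_eq_of_finrank_add_one (by omega) hYM
    ((Submodule.span_singleton_le_iff_mem _ _).2 hm)
    (fun h => hmY ((Submodule.span_singleton_le_iff_mem _ _).1 h))
  -- In u = x + m both summands are singular, so Q u = 0 makes x orthogonal to m. Being orthogonal
  -- to Y as well, x lies in M^⊥ = M.
  have hxM : x ∈ M := by
    rw [← hE.polarPerp_eq_self hM hMn, ← hYm, polarPerp_sup]
    refine ⟨polarPerp_anti Q hYN (hN.le_polarPerp hx), fun y hy => ?_⟩
    obtain ⟨d, rfl⟩ := Submodule.mem_span_singleton.1 hy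
    change polar Q (d • m) x = 0
    have h0 : polar Q x m = 0 := by
      rw [← hxm, QuadraticMap.map_add Q, hN x hx, hM m hm] at hu0
      simpa using hu0
    rw [polar_smul_left, polar_comm, h0, smul_zero]
  have huM : u ∈ M := hxm ▸ M.add_mem hxM hm
  have hYu : Y ⊔ K ∙ u = M := sup_eq_of_finrank_add_one (by omega) hYM
    ((Submodule.span_singleton_le_iff_mem _ _).2 huM)
    (fun h => huN (hYN ((Submodule.span_singleton_le_iff_mem _ _).1 h)))
  rw [← hYu]
  refine hYs.sup (isStable_span ?_)
  rintro _ rfl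
  exact hur

/-! ### A subspace of the geometry containing the rational points. -/

/-- The elements of type `n - 1` that contain a stable subspace of dimension `n - 2` or lie in a
stable maximal totally singular subspace. -/
def nearStable (Q : QuadraticForm K V) (E : Basis (Fin n × Fin 2) K V) (K₀ : Subfield K) :
    Set (PolarElement Q (n - 1)) :=
  {Y | (∃ Z, IsStable E K₀ Z ∧ finrank K Z + 2 = n ∧ Z ≤ Y.1) ∨
    ∃ M, IsTotallySingular Q M ∧ IsStable E K₀ M ∧ finrank K M = n ∧ Y.1 ≤ M}

theorem IsHyperbolicBasis.rationalPoints_subset_nearStable (hE : IsHyperbolicBasis Q E)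
    (hW : HasWittIndex Q n) : rationalPoints Q (n - 1) E K₀ ⊆ nearStable Q E K₀ :=
  fun Y hY => Or.inr (hE.exists_stable_maximal hW Y.2.1 (IsRationalSubspace.isStable hY))

/-- For each combination of the reasons why two points of a line are in the set, X or M turns out to
be stable. Both alternatives are needed: two points lying in stable maximal subspaces other than M
only make X stable. -/
theorem IsHyperbolicBasis.isSubspace_nearStable (hE : IsHyperbolicBasis Q E)
    (hW : HasWittIndex Q n) :
    (polarGrassmannian Q (n - 1)).IsSubspace (nearStable Q E K₀) := by
  have : FiniteDimensional K V := E.finiteDimensional_of_finite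
  rintro ℓ ⟨X, M, hM, -, hXn, hMn, rfl⟩ ⟨Y₁, hY₁, hY₁n⟩ ⟨hXY₁, hY₁M⟩ ⟨Y₂, hY₂, hY₂n⟩ ⟨hXY₂, hY₂M⟩
    hne h₁ h₂
  replace hne : Y₁ ≠ Y₂ := fun h => hne (Subtype.ext h)
  simp only at hXY₁ hY₁M hXY₂ hY₂M
  have hMn' : finrank K M = n := by omega
  have hinf : Y₁ ⊓ Y₂ = X := inf_eq_of_finrank_add_one (by omega) hXY₁ hXY₂
    (not_le_of_finrank_eq (by omega) hne)
  have ofM : IsStable E K₀ M → polarLine Q (n - 1) X M ⊆ nearStable Q E K₀ :=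
    fun hs Y hY => Or.inr ⟨M, hM, hs, hMn', hY.2⟩
  have ofX : IsStable E K₀ X → polarLine Q (n - 1) X M ⊆ nearStable Q E K₀ :=
    fun hs Y hY => Or.inl ⟨X, hs, by omega, hY.1⟩
  have eqX : ∀ {Z : Submodule K V}, finrank K Z + 2 = n → Z ≤ Y₁ → Z ≤ Y₂ → Z = X :=
    fun hZ h h' => Submodule.eq_of_le_of_finrank_le (hinf ▸ le_inf h h') (by omega)
  -- Here M = Y' + Z, and the projection of N to Z contains both terms, so it equals M.
  have mixed : ∀ {Y Y' Z N : Submodule K V}, finrank K Y' + 1 = n → Y ≤ M → Y' ≤ M →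
      IsStable E K₀ Z → Z ≤ Y → ¬ Z ≤ Y' → IsTotallySingular Q N → IsStable E K₀ N →
      finrank K N = n → Y' ≤ N → IsStable E K₀ M := by
    intro Y Y' Z N hY'n hYM hY'M hZs hZY hZY' hN hNs hNn hY'N
    have hZM := hZY.trans hYM
    obtain ⟨h1, h2, -⟩ := hE.stable_projection hW hN hNn hNs (hM.mono hZM) hZs
    have hle : M ≤ Z ⊔ N ⊓ polarPerp Q Z := by
      rw [← sup_eq_of_finrank_add_one (A := Y') (B := Z) (by omega) hY'M hZM hZY']
      exact sup_le (le_sup_of_le_right (le_inf hY'N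
        (hY'M.trans (hM.le_polarPerp.trans (polarPerp_anti Q hZM))))) le_sup_left
    exact hW.eq_of_le hMn' h1 hle ▸ h2
  rcases h₁ with ⟨Z₁, hZ₁s, hZ₁n, hZ₁⟩ | ⟨M₁, hM₁, hM₁s, hM₁n, hYM₁⟩ <;>
  rcases h₂ with ⟨Z₂, hZ₂s, hZ₂n, hZ₂⟩ | ⟨M₂, hM₂, hM₂s, hM₂n, hYM₂⟩ <;>
  simp only at *
  · by_cases h12 : Z₁ ≤ Y₂
    · exact ofX (eqX hZ₁n hZ₁ h12 ▸ hZ₁s)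
    have hs := hZ₁s.sup hZ₂s
    have hle : Z₁ ⊔ Z₂ ≤ M := sup_le (hZ₁.trans hY₁M) (hZ₂.trans hY₂M)
    have hlt : Z₂ < Z₁ ⊔ Z₂ := right_lt_sup.2 fun h => h12 (h.trans hZ₂)
    have hlt' := Submodule.finrank_lt_finrank_of_lt hlt
    have hle' := Submodule.finrank_mono hle
    -- Z₁ + Z₂ is stable and strictly larger than Z₂, so it is M or a hyperplane of M.
    rcases (show finrank K ↥(Z₁ ⊔ Z₂) = n ∨ finrank K ↥(Z₁ ⊔ Z₂) + 1 = n by omega) with h | h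
    · exact ofM (Submodule.eq_of_le_of_finrank_le hle (by omega) ▸ hs)
    · exact ofM (hE.isStable_of_hyperplane hW hs h hM hMn' hle)
  · by_cases h12 : Z₁ ≤ Y₂
    · exact ofX (eqX hZ₁n hZ₁ h12 ▸ hZ₁s)
    · exact ofM (mixed (by omega) hY₁M hY₂M hZ₁s hZ₁ h12 hM₂ hM₂s hM₂n hYM₂)
  · by_cases h12 : Z₂ ≤ Y₁
    · exact ofX (eqX hZ₂n h12 hZ₂ ▸ hZ₂s)
    · exact ofM (mixed (by omega) hY₂M hY₁M hZ₂s hZ₂ h12 hM₁ hM₁s hM₁n hYM₁)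
  · by_cases e₁ : M₁ = M
    · exact ofM (e₁ ▸ hM₁s)
    by_cases e₂ : M₂ = M
    · exact ofM (e₂ ▸ hM₂s)
    have := hW.inf_eq_of_adjacent hM hMn' hM₁ hM₁n hM₂ hM₂n (by omega) (by omega) (by omega)
      hXY₁ hXY₂ hY₁M hY₂M hYM₁ hYM₂ e₁ e₂ hne
    exact ofX (this ▸ hM₁s.inf hM₂s)

/-! ### A point outside this subspace over a proper subfield. -/

/-- If c ≠ 0, some l has l(c) ≠ 0, and then a = l(ac)/l(c) would lie in K₀. -/
theorem eq_zero_of_forall_map_mul_eq {a : K} (ha : a ∉ K₀) {c : K}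
    (h : ∀ l : K →ₗ[K₀] K₀, (l (a * c) : K) = a * l c) : c = 0 := by
  refine (Module.forall_dual_apply_eq_zero_iff K₀ c).1 fun l => ?_
  by_contra h0
  have h0' : (l c : K) ≠ 0 := fun e => h0 (Subtype.ext e)
  refine ha ?_
  rw [eq_div_of_mul_eq h0' (h l).symm]
  exact div_mem (l _).2 (l c).2

theorem IsHyperbolicBasis.apply_basis (hE : IsHyperbolicBasis Q E) (p : Fin n × Fin 2) :
    Q (E p) = 0 := by
  classical
  obtain ⟨i, s⟩ := p
  rw [hE]
  refine Finset.sum_eq_zero fun j _ => ?_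
  fin_cases s <;> simp [Finsupp.single_apply]

/-- If `K₀` is a proper subfield, some element of type `n - 1` contains no stable subspace of
dimension `n - 2` and lies in no stable maximal totally singular subspace. -/
theorem IsHyperbolicBasis.exists_notMem_nearStable (hE : IsHyperbolicBasis Q E) (hn : 3 ≤ n)
    (hK₀ : K₀ ≠ ⊤) : ∃ Y, Y ∉ nearStable Q E K₀ := by
  classical
  have : FiniteDimensional K V := E.finiteDimensional_of_finite
  obtain ⟨a, ha⟩ : ∃ a, a ∉ K₀ := by
    by_contra! h
    exact hK₀ (eq_top_iff.2 fun x _ => h x)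
  let i₀ : Fin n := ⟨0, by omega⟩
  let i₁ : Fin n := ⟨1, by omega⟩
  let i₂ : Fin n := ⟨2, by omega⟩
  have h01 : i₀ ≠ i₁ := by simp [i₀, i₁]
  -- Dropping the index `i₂` leaves n - 1 generators. The sign in -a makes the two twisted ones
  -- orthogonal, and `σ` names a coordinate dual to each generator.
  let ι := {i : Fin n // i ≠ i₂}
  let g : ι → V := fun i =>
    if i.1 = i₀ then a • E (i₀, 0) + E (i₁, 1)
    else if i.1 = i₁ then -a • E (i₁, 0) + E (i₀, 1) else E (i.1, 0)
  let σ : ι → Fin n × Fin 2 := fun i =>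
    if i.1 = i₀ then (i₁, 1) else if i.1 = i₁ then (i₀, 1) else (i.1, 0)
  let p₀ : ι := ⟨i₀, by simp [i₀, i₂]⟩
  let p₁ : ι := ⟨i₁, by simp [i₁, i₂]⟩
  have hg₀ : g p₀ = a • E (i₀, 0) + E (i₁, 1) := by simp [g, p₀]
  have hg₁ : g p₁ = -a • E (i₁, 0) + E (i₀, 1) := by simp [g, p₁, h01.symm]
  have hg : ∀ i : ι, i ≠ p₀ → i ≠ p₁ → g i = E (i.1, 0) := fun i h h' => by
    have e : i.1 ≠ i₀ := fun e => h (Subtype.ext e)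
    have e' : i.1 ≠ i₁ := fun e => h' (Subtype.ext e)
    simp [g, e, e']
  have hpolar₀ : ∀ v, polar Q (g p₀) v = a * E.repr v (i₀, 1) + E.repr v (i₁, 0) := fun v => by
    rw [hg₀, polar_add_left, polar_smul_left, hE.polar_self_zero, hE.polar_self_one, smul_eq_mul]
  have hpolar₁ : ∀ v, polar Q (g p₁) v = -a * E.repr v (i₁, 1) + E.repr v (i₀, 0) := fun v => by
    rw [hg₁, polar_add_left, polar_smul_left, hE.polar_self_zero, hE.polar_self_one, smul_eq_mul]
  have hQg : ∀ i, Q (g i) = 0 := by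
    intro i
    by_cases h : i = p₀
    · rw [h, hg₀, QuadraticMap.map_add Q, QuadraticMap.map_smul, hE.apply_basis, hE.apply_basis,
        polar_smul_left, hE.polar_self_zero]
      simp [h01.symm]
    by_cases h' : i = p₁
    · rw [h', hg₁, QuadraticMap.map_add Q, QuadraticMap.map_smul, hE.apply_basis, hE.apply_basis,
        polar_smul_left, hE.polar_self_zero]
      simp [h01]
    · rw [hg i h h', hE.apply_basis]
  have hne : ∀ i : ι, i ≠ p₀ → i.1 ≠ i₀ := fun i h e => h (Subtype.ext e)
  have hne' : ∀ i : ι, i ≠ p₁ → i.1 ≠ i₁ := fun i h e => h (Subtype.ext e)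
  have h₀₁ : polar Q (g p₀) (g p₁) = 0 := by
    rw [hpolar₀, hg₁]
    simp [h01]
  have hpg : ∀ i j, i ≠ j → polar Q (g i) (g j) = 0 := by
    intro i j hij
    by_cases h : i = p₀
    · subst h
      by_cases h' : j = p₁
      · rw [h', h₀₁]
      · rw [hpolar₀, hg j hij.symm h']
        simp [hne' j h']
    by_cases h' : i = p₁
    · subst h'
      by_cases h' : j = p₀
      · rw [h', polar_comm, h₀₁]
      · rw [hpolar₁, hg j h' hij.symm]
        simp [hne j h']
    rw [hg i h h', hE.polar_self_zero]
    by_cases hj : j = p₀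
    · rw [hj, hg₀]
      simp [(hne' i h').symm]
    by_cases hj' : j = p₁
    · rw [hj', hg₁]
      simp [(hne i h).symm]
    · rw [hg j hj hj']
      simp
  let L : V →ₗ[K] ι → K := LinearMap.pi fun i => E.coord (σ i)
  have hp : p₁ ≠ p₀ := fun h => h01 (congrArg Subtype.val h).symm
  have hσ₀ : σ p₀ = (i₁, 1) := by simp [σ, p₀]
  have hσ₁ : σ p₁ = (i₀, 1) := by simp [σ, p₁, h01.symm]
  have hσ : ∀ i : ι, i ≠ p₀ → i ≠ p₁ → σ i = (i.1, 0) := fun i h h' => by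
    simp [σ, hne i h, hne' i h']
  have hL : ∀ i, L (g i) = Pi.single i 1 := by
    intro i
    ext j
    change E.repr (g i) (σ j) = _
    rcases eq_or_ne j p₀ with rfl | hj
    · rw [hσ₀]
      rcases eq_or_ne i p₀ with rfl | hi
      · simp [hg₀]
      rcases eq_or_ne i p₁ with rfl | hi'
      · simp [hg₁, h01, hp.symm]
      · simp [hg i hi hi', hi.symm]
    rcases eq_or_ne j p₁ with rfl | hj'
    · rw [hσ₁]
      rcases eq_or_ne i p₀ with rfl | hi
      · simp [hg₀, h01.symm, hp]
      rcases eq_or_ne i p₁ with rfl | hi'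
      · simp [hg₁]
      · simp [hg i hi hi', hi'.symm]
    · rw [hσ j hj hj']
      rcases eq_or_ne i p₀ with rfl | hi
      · simp [hg₀, (hne j hj).symm, hj]
      rcases eq_or_ne i p₁ with rfl | hi'
      · simp [hg₁, (hne' j hj').symm, hj']
      · rw [hg i hi hi', Basis.repr_self, Finsupp.single_apply, Pi.single_apply]
        exact if_congr ⟨fun h => Subtype.ext (congrArg Prod.fst h).symm, fun h => by rw [h]⟩ rfl rfl
  have hli : LinearIndependent K g := by
    refine LinearIndependent.of_comp L ?_
    have : L ∘ g = Pi.basisFun K ι := by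
      ext i
      simp [hL]
    rw [this]
    exact (Pi.basisFun K ι).linearIndependent
  have hcard : Fintype.card ι = n - 1 := by
    simp [ι]
  let Y := Submodule.span K (Set.range g)
  have hYn : finrank K Y = n - 1 := by rw [finrank_span_eq_card hli, hcard]
  have hgY : ∀ i, g i ∈ Y := fun i => Submodule.subset_span ⟨i, rfl⟩
  have hY := isTotallySingular_span_range hQg hpg
  -- Orthogonality of Y to its two twisted generators forces pairs of coordinates into the
  -- irrational ratios a and -a.
  have hrel : ∀ y ∈ Y, a * E.repr y (i₁, 1) = E.repr y (i₀, 0) ∧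
      -a * E.repr y (i₀, 1) = E.repr y (i₁, 0) := by
    intro y hy
    have e₀ := hpolar₀ y
    have e₁ := hpolar₁ y
    rw [hY.polar_eq_zero (hgY _) hy] at e₀ e₁
    constructor
    · linear_combination e₁
    · linear_combination e₀
  refine ⟨⟨Y, hY, hYn⟩, ?_⟩
  rintro (⟨Z, hZs, hZn, hZY⟩ | ⟨M, hM, hMs, -, hYM⟩)
  · simp only at hZY
    have hna : -a ∉ K₀ := fun h => ha (neg_mem_iff.1 h)
    -- By stability the ratios persist after applying any `l`, which forces these coordinates to
    -- vanish. Hence `Z` lies in the span of the n - 3 untwisted generators, too small for dimension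
    -- n - 2.
    have hZ : ∀ z ∈ Z, E.repr z (i₁, 1) = 0 ∧ E.repr z (i₀, 1) = 0 := by
      intro z hz
      obtain ⟨r₀, r₁⟩ := hrel z (hZY hz)
      constructor
      · refine eq_zero_of_forall_map_mul_eq ha fun l => ?_
        have := (hrel _ (hZY (hZs l z hz))).1
        rw [repr_coordMap, repr_coordMap] at this
        rw [r₀, this]
      · refine eq_zero_of_forall_map_mul_eq hna fun l => ?_
        have := (hrel _ (hZY (hZs l z hz))).2
        rw [repr_coordMap, repr_coordMap] at this
        rw [r₁, this]
    let T : Finset ι := (Finset.univ.erase p₀).erase p₁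
    have hT : T.card = n - 3 := by
      rw [Finset.card_erase_of_mem (Finset.mem_erase.2 ⟨hp, Finset.mem_univ _⟩),
        Finset.card_erase_of_mem (Finset.mem_univ _), Finset.card_univ, hcard]
      omega
    have hle : Z ≤ Submodule.span K (T.image g : Finset V) := by
      intro z hz
      obtain ⟨c, rfl⟩ := (Submodule.mem_span_range_iff_exists_fun K).1 (hZY hz)
      have hLc : L (∑ i, c i • g i) = c := by
        rw [map_sum]
        simp_rw [map_smul, hL]
        exact (pi_eq_sum_univ' c).symm
      obtain ⟨h₀, h₁⟩ := hZ _ hz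
      refine Submodule.sum_mem _ fun i _ => ?_
      by_cases h : i = p₀
      · have : c p₀ = 0 := by
          rw [← congrFun hLc p₀, ← h₀]
          simp [L, σ, p₀]
        rw [h, this, zero_smul]
        exact Submodule.zero_mem _
      by_cases h' : i = p₁
      · have : c p₁ = 0 := by
          rw [← congrFun hLc p₁, ← h₁]
          simp [L, σ, p₁, h01.symm]
        rw [h', this, zero_smul]
        exact Submodule.zero_mem _
      · refine Submodule.smul_mem _ _ (Submodule.subset_span ?_)
        exact Finset.mem_coe.2 (Finset.mem_image_of_mem g (by simp [T, h, h']))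
    have h1 := Submodule.finrank_mono hle
    have h2 := finrank_span_finset_le_card (R := K) (T.image g)
    have h3 := Finset.card_image_le (s := T) (f := g)
    rw [Set.finrank] at h2
    omega
  · simp only at hYM
    -- A stable `M` also contains l(a) e₀ + l(1) f₁, whose orthogonality to -a e₁ + f₀ says l(a) = a
    -- l(1) for every l.
    refine one_ne_zero (eq_zero_of_forall_map_mul_eq ha (c := 1) fun l => ?_)
    have h := hM.polar_eq_zero (hYM (hgY p₁)) (hMs l _ (hYM (hgY p₀)))
    rw [hpolar₁, repr_coordMap, repr_coordMap, hg₀] at h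
    simp [h01, h01.symm] at h
    rw [mul_one]
    linear_combination h

end StablePolar

theorem corollary1p2 {K V : Type*} [Field K] [AddCommGroup V] [Module K V]
    (n : ℕ) (hn : 3 ≤ n) (hV : Module.finrank K V = 2 * n)
    (Q : QuadraticForm K V) (hQ : Q.radical = ⊥) (hW : HasWittIndex Q n) :
    (∃ E : Module.Basis (Fin n × Fin 2) K V, IsHyperbolicBasis Q E) ∧
    ∀ E : Module.Basis (Fin n × Fin 2) K V, IsHyperbolicBasis Q E →
      ∀ K₀ : Subfield K, K₀ ≠ ⊤ → ¬ IsGeneratedOver Q (n - 1) E K₀ := by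
  have : FiniteDimensional K V := Module.finite_of_finrank_pos (by omega)
  refine ⟨exists_isHyperbolicBasis hV hQ hW, fun E hE K₀ hK₀ hgen => ?_⟩
  obtain ⟨Y, hY⟩ := hE.exists_notMem_nearStable hn hK₀
  have hmem : Y ∈ (polarGrassmannian Q (n - 1)).generated (rationalPoints Q (n - 1) E K₀) :=
    hgen ▸ Set.mem_univ Y
  exact hY (hmem _ ⟨hE.isSubspace_nearStable hW, hE.rationalPoints_subset_nearStable hW⟩)
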